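/- Let $P$ be the transition matrix of a time-reversible ergodic (irreducible and aperiodic) Markov chain on $\{0,1,\dots,n\}$ with stationary distribution $\pi$ (a row vector). Let $P_0$ be $P$ with row $0$ and column $0$ deleted. All eigenvalues of $P$ and $P_0$ are real; consider the spectra $\sigma(P)$ and $\sigma(P_0)$ as multisets and remove the multiset $\sigma(P)\cap\sigma(P_0)$ from each. Denote the remaining (reduced) eigenvalues of $P$ by $\lambda_0\ge\lambda_1\ge\dots\ge\lambda_r$ and those of $P_0$ by $\gamma_1\ge\dots\ge\gamma_r$ (these strictly interlace: $1=\lambda_0>\gamma_1>\lambda_1>\dots>\gamma_r>\lambda_r>-1$), and assume $\lambda_r\ge 0$. Put $\rho_i=\frac{1-\gamma_i}{1-\lambda_i}$ for $1\le i\le r$, and define a row vector $\pi^*$ on $\{0,\dots,r\}$ by $$\pi^*(0)=\prod_{j=1}^r\rho_j,\qquad \pi^*(i)=(1-\rho_i)\prod_{1\le j\le r,\ j\ne i}\frac{1-\gamma_j-\rho_j(1-\gamma_i)}{\gamma_i-\gamma_j}\quad(1\le i\le r).$$ Let $P^*$ be the star-chain matrix on $\{0,\dots,r\}$ given, for $1\le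 i\le r$, by $P^*(i,0)=1-\gamma_i$, $P^*(i,i)=\gamma_i$, $P^*(0,i)=\frac{(1-\gamma_i)\pi^*(i)}{\pi^*(0)}$, $P^*(0,0)=1-\frac1{\pi^*(0)}\sum_{i=1}^r(1-\gamma_i)\pi^*(i)$, with all other entries $0$. Let $P_{\mathrm{abs}}$ and $P^*_{\mathrm{abs}}$ be obtained from $P$ and $P^*$ by replacing row $0$ by $\delta_0=(1,0,\dots,0)$. Then there exists a real $(r+1)\times(n+1)$ matrix $\Lambda_1$ (not necessarily nonnegative) with all row sums equal to $1$ such that $$\pi=\pi^*\Lambda_1,\qquad \Lambda_1P_{\mathrm{abs}}=P^*_{\mathrm{abs}}\Lambda_1,\qquad \Lambda_1\delta_0^T=\delta_0^T,$$ that is, $\Lambda_1$ provides a quasi-intertwining of $(\pi,P_{\mathrm{abs}})$ and $(\pi^*,P^*_{\mathrm{abs}})$ whose column $0$ is $\delta_0^T$. Moreover $\Lambda_1$ can be chosen so that its row $0$ is $\delta_0$ and, for $1\le i\le r$, its row $i$ is $\delta_0+(-v_i\vec 1^{\,T}\mid v_i)$, where $v_i\in\mathbb R^n$ is a left eigenvector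 of $P_0$ with eigenvalue $\gamma_i$. -/

import Mathlib

noncomputable section

namespace StarLink

/-- The submatrix `A₀` obtained by deleting row `0` and column `0`. -/
def delZero {n : ℕ} (A : Matrix (Fin (n + 1)) (Fin (n + 1)) ℝ) : Matrix (Fin n) (Fin n) ℝ :=
  A.submatrix Fin.succ Fin.succ

/-- The matrix obtained by turning state `0` into an absorbing state: row `0` is replaced by the
row vector `δ₀`. -/
def absorb {n : ℕ} (A : Matrix (Fin (n + 1)) (Fin (n + 1)) ℝ) :
    Matrix (Fin (n + 1)) (Fin (n + 1)) ℝ :=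
  A.updateRow 0 (Pi.single 0 1)

/-- The multiset of real eigenvalues of `A`, with algebraic multiplicities. (It is only used for
matrices all of whose eigenvalues are real.) -/
def spec {m : ℕ} (A : Matrix (Fin m) (Fin m) ℝ) : Multiset ℝ := A.charpoly.roots

/-- The eigenvalues of `P` left after removing the multiset `σ(P) ∩ σ(P₀)` from `σ(P)`. -/
def redSpec {n : ℕ} (P : Matrix (Fin (n + 1)) (Fin (n + 1)) ℝ) : Multiset ℝ :=
  spec P - spec P ∩ spec (delZero P)

/-- The eigenvalues of `P₀` left after removing the multiset `σ(P) ∩ σ(P₀)` from `σ(P₀)`. -/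
def redSpecZero {n : ℕ} (P : Matrix (Fin (n + 1)) (Fin (n + 1)) ℝ) : Multiset ℝ :=
  spec (delZero P) - spec P ∩ spec (delZero P)

/-- The number `r` of reduced eigenvalues of `P₀`. -/
def numRed {n : ℕ} (P : Matrix (Fin (n + 1)) (Fin (n + 1)) ℝ) : ℕ := (redSpecZero P).card

/-- The reduced eigenvalues `γ₁ ≥ ⋯ ≥ γ_r` of `P₀`; here `γ_{i+1}` is `redGamma P i`. -/
def redGamma {n : ℕ} (P : Matrix (Fin (n + 1)) (Fin (n + 1)) ℝ) (i : Fin (numRed P)) : ℝ :=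
  ((redSpecZero P).sort (· ≥ ·)).get (i.cast (Multiset.length_sort (· ≥ ·)).symm)

/-- The reduced eigenvalues `λ₀ ≥ ⋯ ≥ λ_r` of `P`. (For a reversible chain `σ(P)` and `σ(P₀)`
have `n + 1` and `n` elements, so that the list has length `r + 1` and the default value of `getD`
is never used.) -/
def redLambda {n : ℕ} (P : Matrix (Fin (n + 1)) (Fin (n + 1)) ℝ) (i : Fin (numRed P + 1)) : ℝ :=
  ((redSpec P).sort (· ≥ ·)).getD i 0

section Star

/-! For the star chain, `gam i` stands for `γ_{i+1}` and belongs to the spoke `i.succ`, while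
`lam` is indexed from `0` to `r`. -/

variable {r : ℕ} (lam : Fin (r + 1) → ℝ) (gam : Fin r → ℝ)

/-- `ρ_i = (1 - γ_i) / (1 - λ_i)`, for `i = 1, …, r`. -/
def rho (i : Fin r) : ℝ := (1 - gam i) / (1 - lam i.succ)

/-- The distribution `π*` on the states `0, …, r` of the star. -/
def starPi : Fin (r + 1) → ℝ :=
  Fin.cons (∏ j, rho lam gam j) fun i =>
    (1 - rho lam gam i) *
      ∏ j ∈ Finset.univ.erase i,
        (1 - gam j - rho lam gam j * (1 - gam i)) / (gam i - gam j)

/-- The transition matrix `P*` of the star chain with hub `0`: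
`P*(0,0) = 1 - π*(0)⁻¹ ∑ i, (1 - γ_i) π*(i)`, `P*(0,i) = (1 - γ_i) π*(i) / π*(0)`,
`P*(i,0) = 1 - γ_i`, `P*(i,i) = γ_i`, and all other entries vanish. -/
def starP : Matrix (Fin (r + 1)) (Fin (r + 1)) ℝ :=
  Matrix.of (Fin.cons
    (Fin.cons
      (1 - 1 / starPi lam gam 0 * ∑ i, (1 - gam i) * starPi lam gam i.succ)
      fun i => (1 - gam i) * starPi lam gam i.succ / starPi lam gam 0)
    fun i => Fin.cons (1 - gam i) fun j => if i = j then gam i else 0)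

end Star

/-- `Λ` (rows summing to one, not necessarily nonnegative) is a quasi-link providing a
quasi-intertwining of `(π, P)` and `(π', P')`. -/
structure IsQuasiIntertwining {a b : ℕ} (pi : Fin a → ℝ) (P : Matrix (Fin a) (Fin a) ℝ)
    (pi' : Fin b → ℝ) (P' : Matrix (Fin b) (Fin b) ℝ) (L : Matrix (Fin b) (Fin a) ℝ) : Prop where
  row_sum : ∀ i, ∑ j, L i j = 1
  comm : L * P = P' * L
  init : pi = Matrix.vecMul pi' L

end StarLink

end

/-! Detailed balance splits row `0` of `P`, off the diagonal, into left eigenvectors `u_i` of `P₀`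
for distinct eigenvalues `γ_i`, none of them orthogonal to column `0`; let `a_i` be the total mass
of `u_i`. Because `P` is stochastic, the Schur complement of `t - P₀` in `t - P` is
`(t - 1) (1 + ∑ a_i / (t - γ_i))`. Hence the `γ_i` are the reduced eigenvalues of `P₀`, those of
`P` are `1` and the zeros `λ_i` of the second factor, and
`∏ (t - λ_i) / ∏ (t - γ_i) = 1 + ∑ a_i / (t - γ_i)`.
The value at `t = 1` and the residues at the `γ_i` give `π*(0) = π(0)` and
`π*(i) = π(0) a_i / (1 - γ_i)`. Stationarity, solved for the states other than `0`, says that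
`π = ∑ π(0) / (1 - γ_i) u_i` there, so the link with `v_i = u_i / a_i` carries `π*` to `π`.
-/

namespace StarLink

open Matrix Polynomial

section Stationary

variable {ι R : Type*} [Fintype ι] [DecidableEq ι]

omit [DecidableEq ι] in
theorem pos_of_mem_stdSimplex [Semiring R] [PartialOrder R] [Nontrivial R] {w : ι → R}
    (hw : w ∈ stdSimplex R ι) : 0 < w :=
  lt_of_le_of_ne hw.1 fun h => by simpa [← h] using hw.2

omit [Fintype ι] [DecidableEq ι] in
theorem abs_pos_of_ne_zero {G : Type*} [AddCommGroup G] [LinearOrder G] [IsOrderedAddMonoid G]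
    {u : ι → G} (hu : u ≠ 0) : 0 < |u| :=
  have ⟨i, hi⟩ := Function.ne_iff.1 hu
  Pi.lt_def.2 ⟨fun j => abs_nonneg (u j), i, abs_pos.2 hi⟩

theorem vecMul_pow_eq_self [Semiring R] {A : Matrix ι ι R} {u : ι → R} (hu : u ᵥ* A = u) (k : ℕ) :
    u ᵥ* A ^ k = u := by
  induction k with
  | zero => rw [pow_zero, vecMul_one]
  | succ k ih => rw [pow_succ, ← vecMul_vecMul, ih, hu]

theorem vecMul_eq_self_of_detailed_balance [CommSemiring R] [PartialOrder R] [IsOrderedRing R]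
    {A : Matrix ι ι R} (hA : A ∈ rowStochastic R ι) {w : ι → R}
    (hrev : ∀ i j, w i * A i j = w j * A j i) : w ᵥ* A = w := by
  funext j
  calc ∑ i, w i * A i j = ∑ i, w j * A j i := Finset.sum_congr rfl fun i _ => hrev i j
    _ = w j := by rw [← Finset.mul_sum, sum_row_of_mem_rowStochastic hA, mul_one]

theorem sum_vecMul_of_mem_rowStochastic [Semiring R] [PartialOrder R] [IsOrderedRing R]
    {A : Matrix ι ι R} (hA : A ∈ rowStochastic R ι) (u : ι → R) :
    ∑ j, (u ᵥ* A) j = ∑ i, u i := by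
  simp only [← dotProduct_one]
  rw [← dotProduct_mulVec, one_vecMul_of_mem_rowStochastic hA]

variable [CommRing R] [LinearOrder R] [IsStrictOrderedRing R] {A : Matrix ι ι R} {u w : ι → R}

omit [DecidableEq ι] in
theorem pos_of_vecMul_eq_self (hA : A.IsIrreducible) (hw : 0 < w) (hwA : w ᵥ* A = w) (i : ι) :
    0 < w i := by
  classical
  obtain ⟨hnonneg, j, hj⟩ := Pi.lt_def.1 hw
  obtain ⟨k, -, hk⟩ := (isIrreducible_iff_exists_pow_pos hA.nonneg).1 hA j i
  have hpow : ∀ l, 0 ≤ (A ^ k) l i := fun l => pow_apply_nonneg hA.nonneg k l i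
  rw [← vecMul_pow_eq_self hwA k]
  exact Finset.sum_pos' (fun l _ => mul_nonneg (hnonneg l) (hpow l))
    ⟨j, Finset.mem_univ j, mul_pos hj hk⟩

theorem abs_vecMul_le (hA : A ∈ rowStochastic R ι) (u : ι → R) : |u ᵥ* A| ≤ |u| ᵥ* A := fun j =>
  calc |∑ i, u i * A i j| ≤ ∑ i, |u i * A i j| := Finset.abs_sum_le_sum_abs _ _
    _ = ∑ i, |u i| * A i j := Finset.sum_congr rfl fun i _ => by
      rw [abs_mul, abs_of_nonneg (nonneg_of_mem_rowStochastic hA)]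

theorem abs_vecMul_eq_self (hA : A ∈ rowStochastic R ι) (hu : u ᵥ* A = u) : |u| ᵥ* A = |u| := by
  have hle : |u| ≤ |u| ᵥ* A := by simpa only [hu] using abs_vecMul_le hA u
  have hsum := (Finset.sum_eq_sum_iff_of_le fun j _ => hle j).1
    (sum_vecMul_of_mem_rowStochastic hA |u|).symm
  exact (funext fun j => hsum j (Finset.mem_univ j)).symm

theorem eq_zero_of_vecMul_eq_self (hA : A ∈ rowStochastic R ι) (hirr : A.IsIrreducible)
    (hu : u ᵥ* A = u) {i : ι} (hi : u i = 0) : u = 0 := by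
  by_contra hne
  have hpos := pos_of_vecMul_eq_self hirr (abs_pos_of_ne_zero hne) (abs_vecMul_eq_self hA hu) i
  simp [hi] at hpos

end Stationary

section Charpoly

variable {ι K : Type*} [Fintype ι] [DecidableEq ι] [Field K] {A : Matrix ι ι K}

theorem isRoot_charpoly_iff_exists_vecMul {μ : K} :
    A.charpoly.IsRoot μ ↔ ∃ v ≠ 0, v ᵥ* A = μ • v := by
  rw [IsRoot.def, eval_charpoly, ← exists_vecMul_eq_zero_iff]
  simp only [vecMul_sub, sub_eq_zero, scalar_apply, vecMul_diagonal_const, op_smul_eq_smul,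
    eq_comm (a := μ • _)]

theorem abs_le_one_of_isRoot_charpoly [LinearOrder K] [IsStrictOrderedRing K]
    (hA : A ∈ rowStochastic K ι) {μ : K} (hμ : A.charpoly.IsRoot μ) : |μ| ≤ 1 := by
  obtain ⟨v, hv, hvA⟩ := isRoot_charpoly_iff_exists_vecMul.1 hμ
  have hpos : 0 < ∑ j, |v| j := Fintype.sum_pos (abs_pos_of_ne_zero hv)
  refine le_of_mul_le_mul_right ?_ hpos
  calc |μ| * ∑ j, |v| j = ∑ j, |v ᵥ* A| j := by
        simp only [hvA, Finset.mul_sum, Pi.abs_apply, Pi.smul_apply, smul_eq_mul, abs_mul]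
    _ ≤ ∑ j, (|v| ᵥ* A) j := Finset.sum_le_sum fun j _ => abs_vecMul_le hA v j
    _ = 1 * ∑ j, |v| j := by rw [sum_vecMul_of_mem_rowStochastic hA, one_mul]

end Charpoly

theorem det_eq_mul_det_submatrix_succ {R : Type*} [CommRing R] {n : ℕ}
    (M : Matrix (Fin (n + 1)) (Fin (n + 1)) R) (x : Fin n → R)
    (hx : x ᵥ* M.submatrix Fin.succ Fin.succ = fun j => M 0 j.succ) :
    M.det = (M 0 0 - x ⬝ᵥ fun i => M i.succ 0) * (M.submatrix Fin.succ Fin.succ).det := by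
  set c : Fin (n + 1) → R := Fin.cons 1 (-x)
  have hrow : ∑ k, c k • M k = Fin.cons (M 0 0 - x ⬝ᵥ fun i => M i.succ 0) 0 := by
    funext j
    refine Fin.cases ?_ (fun j => ?_) j
    · simp [c, Fin.sum_univ_succ, dotProduct, sub_eq_add_neg]
    · simpa [c, Fin.sum_univ_succ, add_neg_eq_zero, vecMul, dotProduct] using (congrFun hx j).symm
  have hdet := det_updateRow_sum M 0 c
  have hsub (row) : (M.updateRow 0 row).submatrix Fin.succ Fin.succ =
      M.submatrix Fin.succ Fin.succ := by ext; simp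
  rw [hrow, det_succ_row_zero, Fin.sum_univ_succ] at hdet
  simpa [c, hsub] using hdet.symm

section Enumeration

theorem map_univ_getD_sort {α : Type*} [LinearOrder α] (s : Multiset α) {r : ℕ} (hr : s.card = r)
    (d : α) : Finset.univ.val.map (fun i : Fin r => (s.sort (· ≥ ·)).getD i d) = s := by
  conv_rhs => rw [← s.sort_eq (· ≥ ·)]
  rw [Fin.univ_val_map]
  congr 1
  refine List.ext_getElem ?_ fun i _ hi => ?_
  · rw [List.length_ofFn, Multiset.length_sort, hr]
  · rw [List.getElem_ofFn, List.getD_eq_getElem]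

theorem exists_equiv_of_range_eq {ι κ α : Type*} {f : ι → α} {g : κ → α}
    (hf : Function.Injective f) (hg : Function.Injective g) (h : Set.range f = Set.range g) :
    ∃ e : ι ≃ κ, ∀ i, g (e i) = f i :=
  ⟨(Equiv.ofInjective f hf).trans ((Equiv.setCongr h).trans (Equiv.ofInjective g hg).symm),
    fun i => by simp [Equiv.apply_ofInjective_symm]⟩

end Enumeration

section Spectral

open Module.End in
theorem exists_sum_eigenvectors_of_isSymmetric {𝕜 E : Type*} [RCLike 𝕜] [NormedAddCommGroup E]
    [InnerProductSpace 𝕜 E] [FiniteDimensional 𝕜 E] {T : E →ₗ[𝕜] E} (hT : T.IsSymmetric) (b : E) :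
    ∃ (G : Finset 𝕜) (u : G → E),
      (∀ μ, T (u μ) = μ.1 • u μ ∧ 0 < RCLike.re (inner 𝕜 (u μ) b)) ∧ ∑ μ, u μ = b := by
  classical
  set p : 𝕜 → E := fun μ => (eigenspace T μ).starProjection b
  have hval : Function.Injective (UnifEigenvalues.val T 1) := Subtype.val_injective
  set G : Finset 𝕜 := {μ ∈ (Finset.univ : Finset (Eigenvalues T)).image (·.val) | p μ ≠ 0}
  refine ⟨G, fun μ => p μ, fun μ => ⟨?_, ?_⟩, ?_⟩
  · exact mem_eigenspace_iff.1 (Submodule.starProjection_apply_mem _ b)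
  · have hne : p μ ≠ 0 := (Finset.mem_filter.1 μ.2).2
    rw [Submodule.re_inner_starProjection_eq_normSq]
    have : 0 < ‖p μ‖ := norm_pos_iff.2 hne
    exact pow_pos this 2
  · have hsup : b ∈ ⨆ μ : Eigenvalues T, eigenspace T μ := by
      rw [Submodule.orthogonal_eq_bot_iff.1 hT.orthogonalComplement_iSup_eigenspaces_eq_bot']
      exact Submodule.mem_top
    rw [Finset.sum_coe_sort G p, Finset.sum_filter_ne_zero,
      Finset.sum_image hval.injOn]
    exact hT.orthogonalFamily_eigenspaces'.sum_projection_of_mem_iSup b hsup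

variable {ι : Type*} [Fintype ι] [DecidableEq ι] {A : Matrix ι ι ℝ} {w : ι → ℝ}

/-- Conjugate of `A` by the square root of the diagonal matrix `w`, which is symmetric exactly when
`A` is in detailed balance with the positive weights `w`. -/
noncomputable def symmetrization (w : ι → ℝ) (A : Matrix ι ι ℝ) : Matrix ι ι ℝ :=
  diagonal (fun i => √(w i)) * A * diagonal (fun i => (√(w i))⁻¹)

theorem isHermitian_symmetrization (hw : ∀ i, 0 < w i)
    (hrev : ∀ i j, w i * A i j = w j * A j i) : (symmetrization w A).IsHermitian := by
  ext i j
  have hi := Real.sqrt_pos.2 (hw i)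
  have hj := Real.sqrt_pos.2 (hw j)
  have h := hrev i j
  rw [← Real.mul_self_sqrt (hw i).le, ← Real.mul_self_sqrt (hw j).le] at h
  simp only [symmetrization, conjTranspose_apply, mul_diagonal, diagonal_mul, star_trivial]
  field_simp
  linear_combination -h

theorem charpoly_symmetrization (hw : ∀ i, 0 < w i) :
    (symmetrization w A).charpoly = A.charpoly := by
  have hne (i) : √(w i) ≠ 0 := (Real.sqrt_pos.2 (hw i)).ne'
  rw [symmetrization, mul_assoc, charpoly_mul_comm, mul_assoc, diagonal_mul_diagonal]
  simp [hne]

theorem splits_charpoly_of_detailed_balance (hw : ∀ i, 0 < w i)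
    (hrev : ∀ i j, w i * A i j = w j * A j i) : A.charpoly.Splits := by
  rw [← charpoly_symmetrization hw]
  exact (isHermitian_symmetrization hw hrev).splits_charpoly

omit [DecidableEq ι] in
theorem exists_sum_left_eigenvectors_of_detailed_balance (hw : ∀ i, 0 < w i)
    (hrev : ∀ i j, w i * A i j = w j * A j i) (b : ι → ℝ) :
    ∃ (G : Finset ℝ) (u : G → ι → ℝ),
      (∀ μ, u μ ᵥ* A = μ.1 • u μ ∧ 0 < u μ ⬝ᵥ (b / w)) ∧ ∑ μ, u μ = b := by
  classical
  set s : ι → ℝ := fun i => √(w i)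
  have hs (i) : s i ≠ 0 := (Real.sqrt_pos.2 (hw i)).ne'
  have hss (i) : s i * s i = w i := Real.mul_self_sqrt (hw i).le
  have hH := isHermitian_symmetrization hw hrev
  obtain ⟨G, x, hx, hsum⟩ := exists_sum_eigenvectors_of_isSymmetric
    (isSymmetric_toEuclideanLin_iff.2 hH) (WithLp.toLp 2 (b / s))
  refine ⟨G, fun μ => (x μ).ofLp ᵥ* diagonal s, fun μ => ⟨?_, ?_⟩, ?_⟩
  · have hdiag : diagonal s * A = symmetrization w A * diagonal s := by
      simp [symmetrization, mul_assoc, s, hs]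
    have hsym : (x μ).ofLp ᵥ* symmetrization w A = μ.1 • (x μ).ofLp := by
      conv_lhs => rw [← hH.eq, conjTranspose_eq_transpose_of_trivial, vecMul_transpose]
      exact congrArg WithLp.ofLp (hx μ).1
    rw [vecMul_vecMul, hdiag, ← vecMul_vecMul, hsym, smul_vecMul]
  · have hpos := (hx μ).2
    rw [EuclideanSpace.inner_eq_star_dotProduct] at hpos
    refine hpos.trans_eq (Finset.sum_congr rfl fun i _ => ?_)
    have := hs i
    simp only [Pi.star_apply, star_trivial, Pi.div_apply, vecMul_diagonal, ← hss]
    field_simp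
  · rw [← sum_vecMul, ← WithLp.ofLp_sum, hsum]
    funext i
    rw [vecMul_diagonal]
    exact div_mul_cancel₀ _ (hs i)

end Spectral

section Secular

variable {ι K : Type*} [Fintype ι] [DecidableEq ι] [Field K] {gam a : ι → K}

/-- Numerator of the secular function `1 + ∑ i, a i / (X - γ i)` over the common denominator
`∏ i, (X - γ i)`. -/
noncomputable def secular (gam a : ι → K) : K[X] :=
  Lagrange.nodal Finset.univ gam + ∑ i, C (a i) * Lagrange.nodal (Finset.univ.erase i) gam

theorem degree_sum_nodal_erase_lt :
    (∑ i, C (a i) * Lagrange.nodal (Finset.univ.erase i) gam).degree <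
      (Lagrange.nodal Finset.univ gam).degree := by
  rw [Lagrange.degree_nodal, ← mem_degreeLT]
  refine Submodule.sum_mem _ fun i _ => mem_degreeLT.2 ?_
  grw [C_mul', degree_smul_le, Lagrange.degree_nodal]
  rw [Nat.cast_lt]
  exact Finset.card_erase_lt_of_mem (Finset.mem_univ i)

theorem monic_secular : (secular gam a).Monic :=
  Lagrange.nodal_monic.add_of_left degree_sum_nodal_erase_lt

theorem natDegree_secular : (secular gam a).natDegree = Fintype.card ι := by
  rw [secular, natDegree_add_eq_left_of_degree_lt degree_sum_nodal_erase_lt,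
    Lagrange.natDegree_nodal, Finset.card_univ]

theorem eval_secular {t : K} (ht : ∀ i, t ≠ gam i) :
    (secular gam a).eval t =
      (Lagrange.nodal Finset.univ gam).eval t * (1 + ∑ i, a i / (t - gam i)) := by
  rw [secular, eval_add, eval_finsetSum, mul_add, mul_one, Finset.mul_sum]
  congr 1
  refine Finset.sum_congr rfl fun i hi => ?_
  have hne := sub_ne_zero.2 (ht i)
  rw [Lagrange.nodal_eq_mul_nodal_erase hi]
  simp only [eval_mul, eval_C, eval_sub, eval_X]
  field_simp

theorem eval_secular_node (i : ι) :
    (secular gam a).eval (gam i) = a i * ∏ j ∈ Finset.univ.erase i, (gam i - gam j) := by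
  rw [secular, eval_add, eval_finsetSum, Lagrange.eval_nodal_at_node (Finset.mem_univ i), zero_add,
    Finset.sum_eq_single i, eval_C_mul, Lagrange.eval_nodal]
  · intro j _ hj
    rw [eval_C_mul, Lagrange.eval_nodal_at_node (Finset.mem_erase.2 ⟨hj.symm, Finset.mem_univ i⟩),
      mul_zero]
  · exact fun h => absurd (Finset.mem_univ i) h

omit [DecidableEq ι] in
theorem roots_nodal_univ : (Lagrange.nodal Finset.univ gam).roots = Finset.univ.val.map gam := by
  rw [← roots_multiset_prod_X_sub_C (Finset.univ.val.map gam), Multiset.map_map]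
  rfl

end Secular

section Decomposition

variable {n : ℕ} {P : Matrix (Fin (n + 1)) (Fin (n + 1)) ℝ} {ι κ : Type*} [Fintype ι] [Fintype κ]
  {gam : ι → ℝ} {u : ι → Fin n → ℝ}

/-- Row `0` of `P` without its diagonal entry: the rates at which state `0` is left. -/
def rowZero (P : Matrix (Fin (n + 1)) (Fin (n + 1)) ℝ) (j : Fin n) : ℝ := P 0 j.succ

/-- Column `0` of `P` without its diagonal entry: the rates at which state `0` is entered. -/
def colZero (P : Matrix (Fin (n + 1)) (Fin (n + 1)) ℝ) (j : Fin n) : ℝ := P j.succ 0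

/-- A decomposition of row `0` of `P` into left eigenvectors `u i` of `P₀` with pairwise distinct
eigenvalues `gam i`, none of which is orthogonal to column `0`. These eigenvalues turn out to be
the reduced eigenvalues of `P₀`. -/
structure IsRowZeroDecomposition (P : Matrix (Fin (n + 1)) (Fin (n + 1)) ℝ) (gam : ι → ℝ)
    (u : ι → Fin n → ℝ) : Prop where
  injective : Function.Injective gam
  vecMul_eq : ∀ i, u i ᵥ* delZero P = gam i • u i
  dotProduct_pos : ∀ i, 0 < u i ⬝ᵥ colZero P
  sum_eq : ∑ i, u i = rowZero P

theorem exists_isRowZeroDecomposition {pi : Fin (n + 1) → ℝ} (hpos : ∀ i, 0 < pi i)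
    (hrev : ∀ i j, pi i * P i j = pi j * P j i) :
    ∃ (G : Finset ℝ) (u : G → Fin n → ℝ), IsRowZeroDecomposition P Subtype.val u := by
  obtain ⟨G, u, hu, hsum⟩ := exists_sum_left_eigenvectors_of_detailed_balance
    (A := delZero P) (w := fun j => pi j.succ) (fun j => hpos j.succ)
    (fun i j => hrev i.succ j.succ) (rowZero P)
  have hratio : rowZero P / (fun j => pi j.succ) = (pi 0)⁻¹ • colZero P := by
    funext j
    have h0 := (hpos 0).ne'
    have hj := (hpos j.succ).ne'
    simp only [rowZero, colZero, Pi.div_apply, Pi.smul_apply, smul_eq_mul]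
    field_simp
    linear_combination hrev 0 j.succ
  refine ⟨G, u, Subtype.val_injective, fun μ => (hu μ).1, fun μ => ?_, hsum⟩
  have h := (hu μ).2
  rw [hratio, dotProduct_smul, smul_eq_mul] at h
  exact pos_of_mul_pos_right h (inv_pos.2 (hpos 0)).le

theorem sum_mul_one_sub_of_vecMul_delZero (hP : P ∈ rowStochastic ℝ (Fin (n + 1)))
    {v : Fin n → ℝ} {g : ℝ} (hv : v ᵥ* delZero P = g • v) :
    (∑ j, v j) * (1 - g) = v ⬝ᵥ colZero P := by
  have hcol : delZero P *ᵥ 1 = 1 - colZero P := by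
    funext j
    have := sum_row_of_mem_rowStochastic hP j.succ
    rw [Fin.sum_univ_succ] at this
    simpa [mulVec, dotProduct, delZero, colZero, eq_sub_iff_add_eq'] using this
  have h := congrArg (v ⬝ᵥ ·) hcol
  rw [dotProduct_mulVec, hv, smul_dotProduct, dotProduct_sub, dotProduct_one, smul_eq_mul] at h
  linear_combination -h

namespace IsRowZeroDecomposition

theorem comp_equiv (hu : IsRowZeroDecomposition P gam u) (e : κ ≃ ι) :
    IsRowZeroDecomposition P (gam ∘ e) (u ∘ e) where
  injective := hu.injective.comp e.injective
  vecMul_eq i := hu.vecMul_eq (e i)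
  dotProduct_pos i := hu.dotProduct_pos (e i)
  sum_eq := (e.sum_comp u).trans hu.sum_eq

theorem sum_mul_one_sub_pos (hP : P ∈ rowStochastic ℝ (Fin (n + 1)))
    (hu : IsRowZeroDecomposition P gam u) (i : ι) : 0 < (∑ j, u i j) * (1 - gam i) :=
  (hu.dotProduct_pos i).trans_eq (sum_mul_one_sub_of_vecMul_delZero hP (hu.vecMul_eq i)).symm

theorem sum_ne_zero (hP : P ∈ rowStochastic ℝ (Fin (n + 1)))
    (hu : IsRowZeroDecomposition P gam u) (i : ι) : ∑ j, u i j ≠ 0 :=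
  left_ne_zero_of_mul (hu.sum_mul_one_sub_pos hP i).ne'

theorem one_ne (hP : P ∈ rowStochastic ℝ (Fin (n + 1)))
    (hu : IsRowZeroDecomposition P gam u) (i : ι) : 1 ≠ gam i :=
  sub_ne_zero.1 (right_ne_zero_of_mul (hu.sum_mul_one_sub_pos hP i).ne')

theorem apply_zero_zero (hP : P ∈ rowStochastic ℝ (Fin (n + 1)))
    (hu : IsRowZeroDecomposition P gam u) : P 0 0 = 1 - ∑ i, ∑ j, u i j := by
  rw [Finset.sum_comm, ← sum_row_of_mem_rowStochastic hP 0, Fin.sum_univ_succ,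
    eq_sub_iff_add_eq, add_right_inj]
  simp only [← Finset.sum_apply, hu.sum_eq, rowZero]

theorem schurComplement_eq (hP : P ∈ rowStochastic ℝ (Fin (n + 1)))
    (hu : IsRowZeroDecomposition P gam u) {t : ℝ} (ht : ∀ i, t ≠ gam i) :
    t - P 0 0 - ∑ i, (t - gam i)⁻¹ * (u i ⬝ᵥ colZero P) =
      (t - 1) * (1 + ∑ i, (∑ j, u i j) / (t - gam i)) := by
  have hterm (i) : (t - gam i)⁻¹ * (u i ⬝ᵥ colZero P) =
      ∑ j, u i j - (t - 1) * ((∑ j, u i j) / (t - gam i)) := by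
    rw [← sum_mul_one_sub_of_vecMul_delZero hP (hu.vecMul_eq i)]
    field [sub_ne_zero.2 (ht i)]
  rw [Finset.sum_congr rfl fun i _ => hterm i, Finset.sum_sub_distrib, ← Finset.mul_sum,
    hu.apply_zero_zero hP]
  ring

theorem eval_charpoly (hP : P ∈ rowStochastic ℝ (Fin (n + 1)))
    (hu : IsRowZeroDecomposition P gam u) {t : ℝ} (ht : ∀ i, t ≠ gam i) :
    P.charpoly.eval t =
      (delZero P).charpoly.eval t * ((t - 1) * (1 + ∑ i, (∑ j, u i j) / (t - gam i))) := by
  have hne (i) : t - gam i ≠ 0 := sub_ne_zero.2 (ht i)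
  have hsub : (scalar (Fin (n + 1)) t - P).submatrix Fin.succ Fin.succ =
      scalar (Fin n) t - delZero P := by
    ext i j
    simp [delZero, diagonal_apply]
  have hx : (-∑ i, (t - gam i)⁻¹ • u i) ᵥ* (scalar (Fin (n + 1)) t - P).submatrix Fin.succ Fin.succ
      = fun j => (scalar (Fin (n + 1)) t - P) 0 j.succ := by
    have hterm (i) : ((t - gam i)⁻¹ • u i) ᵥ* (scalar (Fin n) t - delZero P) = u i := by
      rw [smul_vecMul, vecMul_sub, hu.vecMul_eq, scalar_apply, vecMul_diagonal_const,
        op_smul_eq_smul, ← sub_smul, inv_smul_smul₀ (hne i)]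
    rw [hsub, neg_vecMul, sum_vecMul, Finset.sum_congr rfl fun i _ => hterm i, hu.sum_eq]
    funext j
    simp [rowZero, diagonal_apply_ne _ (Fin.succ_ne_zero j).symm]
  have hcol : (fun j : Fin n => (scalar (Fin (n + 1)) t - P) j.succ 0) = -colZero P := by
    funext j
    simp [colZero]
  rw [Matrix.eval_charpoly, det_eq_mul_det_submatrix_succ _ _ hx, hsub, ← Matrix.eval_charpoly,
    mul_comm, ← hu.schurComplement_eq hP ht, hcol, neg_dotProduct_neg, sum_dotProduct]
  simp

theorem nodal_dvd_charpoly (hu : IsRowZeroDecomposition P gam u) :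
    Lagrange.nodal Finset.univ gam ∣ (delZero P).charpoly := by
  refine Finset.prod_dvd_of_coprime
    (fun i _ j _ hij => pairwise_coprime_X_sub_C hu.injective hij) fun i _ => ?_
  rw [dvd_iff_isRoot, isRoot_charpoly_iff_exists_vecMul]
  refine ⟨u i, ?_, hu.vecMul_eq i⟩
  intro h
  simpa [h] using hu.dotProduct_pos i

variable [DecidableEq ι]

theorem exists_charpoly_eq (hP : P ∈ rowStochastic ℝ (Fin (n + 1)))
    (hu : IsRowZeroDecomposition P gam u) :
    ∃ c : ℝ[X], (delZero P).charpoly = c * Lagrange.nodal Finset.univ gam ∧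
      P.charpoly = c * ((X - C 1) * secular gam fun i => ∑ j, u i j) := by
  obtain ⟨c, hc⟩ := hu.nodal_dvd_charpoly
  refine ⟨c, hc.trans (mul_comm _ _), eq_of_infinite_eval_eq _ _ ?_⟩
  refine (Set.finite_range gam).infinite_compl.mono fun t ht => ?_
  have ht' (i) : t ≠ gam i := fun h => ht ⟨i, h.symm⟩
  simp only [Set.mem_ofPred_eq, hu.eval_charpoly hP ht', hc, eval_mul, eval_sub, eval_X, eval_C,
    eval_secular ht']
  ring

end IsRowZeroDecomposition

end Decomposition

section ReducedSpectrum

variable {n : ℕ} {P : Matrix (Fin (n + 1)) (Fin (n + 1)) ℝ} {c p q : ℝ[X]}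

theorem spec_eq_add_of_charpoly_eq_mul {m : ℕ} {A : Matrix (Fin m) (Fin m) ℝ}
    (h : A.charpoly = c * p) : spec A = c.roots + p.roots := by
  rw [spec, h, roots_mul (h ▸ A.charpoly_monic.ne_zero)]

theorem spec_inter_spec_delZero (hP : P.charpoly = c * p) (hP₀ : (delZero P).charpoly = c * q)
    (hpq : Disjoint p.roots q.roots) : spec P ∩ spec (delZero P) = c.roots := by
  rw [spec_eq_add_of_charpoly_eq_mul hP, spec_eq_add_of_charpoly_eq_mul hP₀,
    ← Multiset.add_inter_distrib, Multiset.inter_eq_zero_iff_disjoint.2 hpq, add_zero]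

theorem redSpec_eq_roots (hP : P.charpoly = c * p) (hP₀ : (delZero P).charpoly = c * q)
    (hpq : Disjoint p.roots q.roots) : redSpec P = p.roots := by
  rw [redSpec, spec_inter_spec_delZero hP hP₀ hpq, spec_eq_add_of_charpoly_eq_mul hP,
    add_tsub_cancel_left]

theorem redSpecZero_eq_roots (hP : P.charpoly = c * p) (hP₀ : (delZero P).charpoly = c * q)
    (hpq : Disjoint p.roots q.roots) : redSpecZero P = q.roots := by
  rw [redSpecZero, spec_inter_spec_delZero hP hP₀ hpq, spec_eq_add_of_charpoly_eq_mul hP₀,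
    add_tsub_cancel_left]

theorem map_univ_redGamma (P : Matrix (Fin (n + 1)) (Fin (n + 1)) ℝ) :
    Finset.univ.val.map (redGamma P) = redSpecZero P := by
  rw [← map_univ_getD_sort (redSpecZero P) rfl 0]
  refine Multiset.map_congr rfl fun i _ => ?_
  rw [List.getD_eq_getElem]
  rfl

theorem map_univ_redLambda_succ {s : Multiset ℝ} {a : ℝ} (hs : redSpec P = a ::ₘ s)
    (hle : ∀ x ∈ s, x ≤ a) (hcard : s.card = numRed P) :
    Finset.univ.val.map (redLambda P ∘ Fin.succ) = s := by
  rw [← map_univ_getD_sort s hcard 0]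
  refine Multiset.map_congr rfl fun i _ => ?_
  rw [Function.comp_apply, redLambda, hs, Multiset.sort_cons _ _ _ hle, Fin.val_succ,
    List.getD_cons_succ]

namespace IsRowZeroDecomposition

variable {ι : Type*} [Fintype ι] [DecidableEq ι] {gam : ι → ℝ} {u : ι → Fin n → ℝ}

theorem eval_secular_node_ne_zero (hP : P ∈ rowStochastic ℝ (Fin (n + 1)))
    (hu : IsRowZeroDecomposition P gam u) (i : ι) :
    (secular gam fun i => ∑ j, u i j).eval (gam i) ≠ 0 := by
  rw [eval_secular_node]
  refine mul_ne_zero (hu.sum_ne_zero hP i) (Finset.prod_ne_zero_iff.2 fun j hj => ?_)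
  exact sub_ne_zero.2 (hu.injective.ne (Finset.ne_of_mem_erase hj).symm)

theorem redSpec_eq_and_redSpecZero_eq (hP : P ∈ rowStochastic ℝ (Fin (n + 1)))
    (hu : IsRowZeroDecomposition P gam u) :
    redSpec P = 1 ::ₘ (secular gam fun i => ∑ j, u i j).roots ∧
      redSpecZero P = Finset.univ.val.map gam := by
  obtain ⟨c, hP₀, hPc⟩ := hu.exists_charpoly_eq hP
  have hroots : ((X - C 1) * secular gam fun i => ∑ j, u i j).roots =
      1 ::ₘ (secular gam fun i => ∑ j, u i j).roots := by
    rw [roots_mul ((monic_X_sub_C 1).mul monic_secular).ne_zero, roots_X_sub_C,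
      Multiset.singleton_add]
  have hdisj : Disjoint ((X - C 1) * secular gam fun i => ∑ j, u i j).roots
      (Lagrange.nodal Finset.univ gam).roots := by
    rw [Multiset.disjoint_right, roots_nodal_univ]
    simp only [Multiset.mem_map, Finset.mem_val, Finset.mem_univ, true_and, forall_exists_index,
      forall_apply_eq_imp_iff]
    intro i hi
    rcases Multiset.mem_cons.1 (hroots ▸ hi) with h | h
    · exact hu.one_ne hP i h.symm
    · exact hu.eval_secular_node_ne_zero hP i (isRoot_of_mem_roots h)
  rw [redSpec_eq_roots hPc hP₀ hdisj, redSpecZero_eq_roots hPc hP₀ hdisj, roots_nodal_univ]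
  exact ⟨hroots, rfl⟩

theorem splits_secular (hP : P ∈ rowStochastic ℝ (Fin (n + 1)))
    (hu : IsRowZeroDecomposition P gam u) (hsplit : P.charpoly.Splits) :
    (secular gam fun i => ∑ j, u i j).Splits := by
  obtain ⟨c, -, hPc⟩ := hu.exists_charpoly_eq hP
  refine hsplit.of_dvd P.charpoly_monic.ne_zero ?_
  rw [hPc]
  exact (dvd_mul_left _ _).trans (dvd_mul_left _ _)

theorem nodal_redLambda_succ (hP : P ∈ rowStochastic ℝ (Fin (n + 1)))
    (hu : IsRowZeroDecomposition P gam u) (hsplit : P.charpoly.Splits) :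
    Lagrange.nodal Finset.univ (redLambda P ∘ Fin.succ) = secular gam fun i => ∑ j, u i j := by
  obtain ⟨hred, hred₀⟩ := hu.redSpec_eq_and_redSpecZero_eq hP
  have hS := hu.splits_secular hP hsplit
  have hle : ∀ x ∈ (secular gam fun i => ∑ j, u i j).roots, x ≤ 1 := fun x hx => by
    have hmem : x ∈ redSpec P := hred ▸ Multiset.mem_cons_of_mem hx
    have hroot := isRoot_of_mem_roots (Multiset.mem_of_le (Multiset.sub_le_self _ _) hmem)
    exact (abs_le.1 (abs_le_one_of_isRoot_charpoly hP hroot)).2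
  have hcard : (secular gam fun i => ∑ j, u i j).roots.card = numRed P := by
    rw [numRed, hred₀, Multiset.card_map, ← hS.natDegree_eq_card_roots, natDegree_secular]
    rfl
  rw [hS.eq_prod_roots_of_monic monic_secular, ← map_univ_redLambda_succ hred hle hcard,
    Multiset.map_map]
  rfl

omit [DecidableEq ι] in
theorem exists_redGamma (hP : P ∈ rowStochastic ℝ (Fin (n + 1)))
    (hu : IsRowZeroDecomposition P gam u) :
    ∃ u' : Fin (numRed P) → Fin n → ℝ, IsRowZeroDecomposition P (redGamma P) u' := by
  classical
  have hmap : Finset.univ.val.map (redGamma P) = Finset.univ.val.map gam :=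
    (map_univ_redGamma P).trans (hu.redSpec_eq_and_redSpecZero_eq hP).2
  have hinj : Function.Injective (redGamma P) := fun i j hij =>
    Multiset.inj_on_of_nodup_map (hmap ▸ Finset.univ.nodup.map hu.injective)
      i (Finset.mem_univ i) j (Finset.mem_univ j) hij
  have hrange : Set.range (redGamma P) = Set.range gam := by
    ext x
    simpa using congrArg (x ∈ ·) hmap
  obtain ⟨e, he⟩ := exists_equiv_of_range_eq hinj hu.injective hrange
  exact ⟨u ∘ e, funext he ▸ hu.comp_equiv e⟩

end IsRowZeroDecomposition

end ReducedSpectrum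

section StationaryDistribution

variable {n : ℕ} {P : Matrix (Fin (n + 1)) (Fin (n + 1)) ℝ} {pi : Fin (n + 1) → ℝ}

theorem vecMul_succ (w : Fin (n + 1) → ℝ) :
    (fun j : Fin n => (w ᵥ* P) j.succ) = w 0 • rowZero P + (fun j => w j.succ) ᵥ* delZero P := by
  funext j
  simp [vecMul, dotProduct, Fin.sum_univ_succ, rowZero, delZero]

theorem eq_zero_of_vecMul_delZero_eq_self (hP : P ∈ rowStochastic ℝ (Fin (n + 1)))
    (hirr : P.IsIrreducible) {v : Fin n → ℝ} (hv : v ᵥ* delZero P = v) : v = 0 := by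
  set w : Fin (n + 1) → ℝ := Fin.cons 0 v
  have hw : w ᵥ* P = w := by
    funext j
    refine Fin.cases ?_ (fun j => ?_) j
    · have h := sum_mul_one_sub_of_vecMul_delZero hP (g := 1) (hv.trans (one_smul ℝ v).symm)
      rw [sub_self, mul_zero] at h
      simpa [w, vecMul, dotProduct, Fin.sum_univ_succ, colZero] using h.symm
    · simpa [w, hv] using congrFun (vecMul_succ (P := P) w) j
  have hw0 := eq_zero_of_vecMul_eq_self hP hirr hw (i := 0) rfl
  exact funext fun j => congrFun hw0 j.succ

namespace IsRowZeroDecomposition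

variable {ι : Type*} [Fintype ι] {gam : ι → ℝ} {u : ι → Fin n → ℝ}

theorem stationary_succ (hP : P ∈ rowStochastic ℝ (Fin (n + 1))) (hirr : P.IsIrreducible)
    (hstat : pi ᵥ* P = pi) (hu : IsRowZeroDecomposition P gam u) (j : Fin n) :
    pi j.succ = ∑ i, pi 0 / (1 - gam i) * u i j := by
  set y : Fin n → ℝ := ∑ i, (pi 0 / (1 - gam i)) • u i
  have hy : y ᵥ* delZero P = y - pi 0 • rowZero P := by
    rw [sum_vecMul, ← hu.sum_eq, Finset.smul_sum, ← Finset.sum_sub_distrib]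
    refine Finset.sum_congr rfl fun i _ => ?_
    have hne := sub_ne_zero.2 (hu.one_ne hP i)
    rw [smul_vecMul, hu.vecMul_eq, smul_smul, ← sub_smul]
    congr 1
    field
  have hpi := vecMul_succ (P := P) pi
  rw [hstat] at hpi
  have hzero : (fun j : Fin n => pi j.succ) - y = 0 :=
    eq_zero_of_vecMul_delZero_eq_self hP hirr (by
      rw [sub_vecMul, hy, sub_sub_eq_add_sub, add_comm, ← hpi])
  simpa [y] using congrFun (sub_eq_zero.1 hzero) j

theorem stationary_zero_mul (hP : P ∈ rowStochastic ℝ (Fin (n + 1))) (hirr : P.IsIrreducible)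
    (hsum : ∑ i, pi i = 1) (hstat : pi ᵥ* P = pi) (hu : IsRowZeroDecomposition P gam u) :
    pi 0 * (1 + ∑ i, (∑ j, u i j) / (1 - gam i)) = 1 := by
  have hspokes : ∑ j : Fin n, pi j.succ = pi 0 * ∑ i, (∑ j, u i j) / (1 - gam i) := by
    simp only [hu.stationary_succ hP hirr hstat]
    rw [Finset.sum_comm, Finset.mul_sum]
    refine Finset.sum_congr rfl fun i _ => ?_
    rw [← Finset.mul_sum, div_mul_eq_mul_div, mul_div_assoc]
  rw [mul_add, mul_one, ← hspokes, ← Fin.sum_univ_succ, hsum]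

end IsRowZeroDecomposition

end StationaryDistribution

section StarDistribution

variable {r : ℕ} {lam : Fin (r + 1) → ℝ} {gam a : Fin r → ℝ}

theorem starPi_zero : starPi lam gam 0 = ∏ j, rho lam gam j := rfl

theorem starPi_succ (hlam : ∀ j : Fin r, 1 ≠ lam j.succ) (hgam : ∀ j, 1 ≠ gam j) (i : Fin r) :
    starPi lam gam i.succ = starPi lam gam 0 / (1 - gam i) *
      ((∏ j : Fin r, (gam i - lam j.succ)) / ∏ j ∈ Finset.univ.erase i, (gam i - gam j)) := by
  have hl (j : Fin r) : 1 - lam j.succ ≠ 0 := sub_ne_zero.2 (hlam j)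
  have hg := sub_ne_zero.2 (hgam i)
  have hdiag : 1 - rho lam gam i = rho lam gam i / (1 - gam i) * (gam i - lam i.succ) := by
    rw [rho]
    field [hl i]
  have hoff (j : Fin r) :
      1 - gam j - rho lam gam j * (1 - gam i) = rho lam gam j * (gam i - lam j.succ) := by
    rw [rho]
    field [hl j]
  rw [starPi_zero, ← Finset.mul_prod_erase _ _ (Finset.mem_univ i),
    ← Finset.mul_prod_erase _ (fun j : Fin r => gam i - lam j.succ) (Finset.mem_univ i)]
  simp only [starPi, Fin.cons_succ, hdiag, hoff, Finset.prod_mul_distrib, Finset.prod_div_distrib]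
  ring

theorem prod_one_sub_eq (hgam : ∀ j, 1 ≠ gam j)
    (hsec : Lagrange.nodal Finset.univ (lam ∘ Fin.succ) = secular gam a) :
    ∏ j : Fin r, (1 - lam j.succ) = (∏ j, (1 - gam j)) * (1 + ∑ i, a i / (1 - gam i)) := by
  rw [← Lagrange.eval_nodal (v := gam), ← eval_secular hgam, ← hsec, Lagrange.eval_nodal]
  rfl

theorem starPi_zero_mul_of_nodal_eq_secular (hlam : ∀ j : Fin r, 1 ≠ lam j.succ)
    (hgam : ∀ j, 1 ≠ gam j) (hsec : Lagrange.nodal Finset.univ (lam ∘ Fin.succ) = secular gam a) :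
    starPi lam gam 0 * (1 + ∑ i, a i / (1 - gam i)) = 1 := by
  simp only [starPi_zero, rho]
  rw [Finset.prod_div_distrib, div_mul_eq_mul_div, ← prod_one_sub_eq hgam hsec]
  exact div_self (Finset.prod_ne_zero_iff.2 fun j _ => sub_ne_zero.2 (hlam j))

theorem starPi_succ_of_nodal_eq_secular (hlam : ∀ j : Fin r, 1 ≠ lam j.succ)
    (hgam : ∀ j, 1 ≠ gam j) (hinj : Function.Injective gam)
    (hsec : Lagrange.nodal Finset.univ (lam ∘ Fin.succ) = secular gam a) (i : Fin r) :
    starPi lam gam i.succ = starPi lam gam 0 / (1 - gam i) * a i := by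
  have hres : ∏ j : Fin r, (gam i - lam j.succ) =
      a i * ∏ j ∈ Finset.univ.erase i, (gam i - gam j) := by
    rw [← eval_secular_node, ← hsec, Lagrange.eval_nodal]
    rfl
  rw [starPi_succ hlam hgam, hres, mul_div_cancel_right₀]
  exact Finset.prod_ne_zero_iff.2 fun j hj =>
    sub_ne_zero.2 (hinj.ne (Finset.ne_of_mem_erase hj).symm)

theorem one_ne_of_nodal_eq_secular (hgam : ∀ j, 1 ≠ gam j)
    (hsec : Lagrange.nodal Finset.univ (lam ∘ Fin.succ) = secular gam a)
    (h1 : 1 + ∑ i, a i / (1 - gam i) ≠ 0) (j : Fin r) : 1 ≠ lam j.succ := by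
  have hprod : ∏ j : Fin r, (1 - lam j.succ) ≠ 0 := by
    rw [prod_one_sub_eq hgam hsec]
    exact mul_ne_zero (Finset.prod_ne_zero_iff.2 fun j _ => sub_ne_zero.2 (hgam j)) h1
  exact sub_ne_zero.1 (Finset.prod_ne_zero_iff.1 hprod j (Finset.mem_univ j))

end StarDistribution

section StarLink

variable {n r : ℕ} {P : Matrix (Fin (n + 1)) (Fin (n + 1)) ℝ} {pi : Fin (n + 1) → ℝ}
  {lam : Fin (r + 1) → ℝ} {gam : Fin r → ℝ} {v : Fin r → Fin n → ℝ}

/-- The link `Λ₁` from the star to the chain: row `0` is `δ₀`, and the row of spoke `i` is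
`δ₀ + (-v_i·1 | v_i)`. -/
def starLink (v : Fin r → Fin n → ℝ) : Matrix (Fin (r + 1)) (Fin (n + 1)) ℝ :=
  Matrix.of (Fin.cons (Pi.single 0 1) fun i => Pi.single 0 1 + Fin.cons (-∑ j, v i j) (v i))

theorem sum_starLink (v : Fin r → Fin n → ℝ) (i : Fin (r + 1)) : ∑ j, starLink v i j = 1 := by
  refine Fin.cases ?_ (fun i => ?_) i <;> simp [starLink, Fin.sum_univ_succ]

theorem starLink_mulVec_single (hsum : ∀ i, ∑ j, v i j = 1) :
    starLink v *ᵥ Pi.single 0 1 = Pi.single 0 1 := by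
  rw [mulVec_single_one]
  funext i
  refine Fin.cases ?_ (fun i => ?_) i <;> simp [starLink, hsum]

theorem starLink_mul_absorb (hP : P ∈ rowStochastic ℝ (Fin (n + 1)))
    (hv : ∀ i, v i ᵥ* delZero P = gam i • v i) :
    starLink v * absorb P = absorb (starP lam gam) * starLink v := by
  ext i j
  refine Fin.cases ?_ (fun i => ?_) i
  · simp [starLink, absorb, mul_apply, Fin.sum_univ_succ]
  · refine Fin.cases ?_ (fun j => ?_) j
    · have hmass := sum_mul_one_sub_of_vecMul_delZero hP (hv i)
      have hentry : 1 + -∑ j, v i j + ∑ k, v i k * P k.succ 0 =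
          1 - gam i + gam i * (1 + -∑ j, v i j) := by
        simp only [dotProduct, colZero] at hmass
        linear_combination -hmass
      simpa [starLink, absorb, starP, mul_apply, Fin.sum_univ_succ] using hentry
    · have hentry : ∑ k, v i k * P k.succ j.succ = gam i * v i j := congrFun (hv i) j
      simpa [starLink, absorb, starP, mul_apply, Fin.sum_univ_succ] using hentry

theorem starPi_vecMul_starLink (hsum : ∀ i, ∑ j, v i j = 1) (h0 : pi 0 = starPi lam gam 0)
    (hsucc : ∀ j : Fin n, pi j.succ = ∑ i, starPi lam gam (Fin.succ i) * v i j) :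
    pi = starPi lam gam ᵥ* starLink v := by
  funext j
  refine Fin.cases ?_ (fun j => ?_) j <;>
    simp [vecMul, dotProduct, Fin.sum_univ_succ, starLink, hsum, h0, hsucc]

theorem isQuasiIntertwining_starLink (hP : P ∈ rowStochastic ℝ (Fin (n + 1)))
    (hv : ∀ i, v i ᵥ* delZero P = gam i • v i) (hsum : ∀ i, ∑ j, v i j = 1)
    (h0 : pi 0 = starPi lam gam 0)
    (hsucc : ∀ j : Fin n, pi j.succ = ∑ i, starPi lam gam (Fin.succ i) * v i j) :
    IsQuasiIntertwining pi (absorb P) (starPi lam gam) (absorb (starP lam gam)) (starLink v) where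
  row_sum := sum_starLink v
  comm := starLink_mul_absorb hP hv
  init := starPi_vecMul_starLink hsum h0 hsucc

end StarLink

section Link

variable {n : ℕ} {P : Matrix (Fin (n + 1)) (Fin (n + 1)) ℝ} {pi : Fin (n + 1) → ℝ}

/-- The vectors `u i` rescaled to total mass one; the junk value `0⁻¹ = 0` never occurs for a
decomposition of row `0`. -/
noncomputable def normalize {ι : Type*} (u : ι → Fin n → ℝ) (i : ι) : Fin n → ℝ :=
  (∑ j, u i j)⁻¹ • u i

namespace IsRowZeroDecomposition

variable {ι : Type*} [Fintype ι] {gam : ι → ℝ} {u : ι → Fin n → ℝ}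

theorem vecMul_normalize (hu : IsRowZeroDecomposition P gam u) (i : ι) :
    normalize u i ᵥ* delZero P = gam i • normalize u i := by
  rw [normalize, smul_vecMul, hu.vecMul_eq, smul_comm]

theorem sum_normalize (hP : P ∈ rowStochastic ℝ (Fin (n + 1)))
    (hu : IsRowZeroDecomposition P gam u) (i : ι) : ∑ j, normalize u i j = 1 := by
  simp only [normalize, Pi.smul_apply, smul_eq_mul]
  rw [← Finset.mul_sum, inv_mul_cancel₀ (hu.sum_ne_zero hP i)]

theorem normalize_ne_zero (hP : P ∈ rowStochastic ℝ (Fin (n + 1)))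
    (hu : IsRowZeroDecomposition P gam u) (i : ι) : normalize u i ≠ 0 := by
  intro h
  simpa [h] using hu.sum_normalize hP i

theorem starPi_eq {u : Fin (numRed P) → Fin n → ℝ} (hP : P ∈ rowStochastic ℝ (Fin (n + 1)))
    (hirr : P.IsIrreducible) (hsplit : P.charpoly.Splits) (hsum : ∑ i, pi i = 1)
    (hstat : pi ᵥ* P = pi) (hu : IsRowZeroDecomposition P (redGamma P) u) :
    starPi (redLambda P) (redGamma P) 0 = pi 0 ∧
      ∀ i : Fin (numRed P), starPi (redLambda P) (redGamma P) i.succ =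
        pi 0 / (1 - redGamma P i) * ∑ j, u i j := by
  have hsec := hu.nodal_redLambda_succ hP hsplit
  have hgam := hu.one_ne hP
  have htotal := hu.stationary_zero_mul hP hirr hsum hstat
  have hne := right_ne_zero_of_mul_eq_one htotal
  have hlam := one_ne_of_nodal_eq_secular hgam hsec hne
  have hzero : starPi (redLambda P) (redGamma P) 0 = pi 0 := mul_right_cancel₀ hne
    ((starPi_zero_mul_of_nodal_eq_secular hlam hgam hsec).trans htotal.symm)
  refine ⟨hzero, fun i => ?_⟩
  rw [starPi_succ_of_nodal_eq_secular hlam hgam hu.injective hsec, hzero]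

theorem stationary_succ_eq_starPi {u : Fin (numRed P) → Fin n → ℝ}
    (hP : P ∈ rowStochastic ℝ (Fin (n + 1))) (hirr : P.IsIrreducible)
    (hsplit : P.charpoly.Splits) (hsum : ∑ i, pi i = 1) (hstat : pi ᵥ* P = pi)
    (hu : IsRowZeroDecomposition P (redGamma P) u) (j : Fin n) :
    pi j.succ = ∑ i, starPi (redLambda P) (redGamma P) (Fin.succ i) * normalize u i j := by
  rw [hu.stationary_succ hP hirr hstat]
  refine Finset.sum_congr rfl fun i _ => ?_
  rw [(hu.starPi_eq hP hirr hsplit hsum hstat).2, normalize, Pi.smul_apply, smul_eq_mul,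
    mul_assoc, mul_inv_cancel_left₀ (hu.sum_ne_zero hP i)]

end IsRowZeroDecomposition

end Link

end StarLink

open StarLink Matrix in
theorem theorem3p10_general (n : ℕ) (P : Matrix (Fin (n + 1)) (Fin (n + 1)) ℝ)
    (pi : Fin (n + 1) → ℝ) (hP : P ∈ Matrix.rowStochastic ℝ (Fin (n + 1)))
    (hirr : P.IsIrreducible) (hpi : pi ∈ stdSimplex ℝ (Fin (n + 1)))
    (hrev : ∀ i j, pi i * P i j = pi j * P j i) :
    ∃ L : Matrix (Fin (numRed P + 1)) (Fin (n + 1)) ℝ,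
      IsQuasiIntertwining pi (absorb P)
        (starPi (redLambda P) (redGamma P))
        (absorb (starP (redLambda P) (redGamma P))) L ∧
      Matrix.mulVec L (Pi.single 0 1) = Pi.single 0 1 ∧
      L 0 = Pi.single 0 1 ∧
      ∀ i : Fin (numRed P), ∃ v : Fin n → ℝ,
        v ≠ 0 ∧ Matrix.vecMul v (delZero P) = redGamma P i • v ∧
        L i.succ = Pi.single 0 1 + Fin.cons (-∑ j, v j) v := by
  have hstat := vecMul_eq_self_of_detailed_balance hP hrev
  have hpos := pos_of_vecMul_eq_self hirr (pos_of_mem_stdSimplex hpi) hstat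
  have hsplit := splits_charpoly_of_detailed_balance hpos hrev
  obtain ⟨_, _, hu₀⟩ := exists_isRowZeroDecomposition hpos hrev
  obtain ⟨u, hu⟩ := hu₀.exists_redGamma hP
  have hsum := hu.sum_normalize hP
  exact ⟨starLink (normalize u),
    isQuasiIntertwining_starLink hP hu.vecMul_normalize hsum
      (hu.starPi_eq hP hirr hsplit hpi.2 hstat).1.symm
      (hu.stationary_succ_eq_starPi hP hirr hsplit hpi.2 hstat),
    starLink_mulVec_single hsum, rfl,
    fun i => ⟨normalize u i, hu.normalize_ne_zero hP i, hu.vecMul_normalize i, rfl⟩⟩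

theorem theorem3p10 (n : ℕ) (P : Matrix (Fin (n + 1)) (Fin (n + 1)) ℝ) (pi : Fin (n + 1) → ℝ)
    -- `P` is the transition matrix of an ergodic (irreducible and aperiodic) chain on `{0, …, n}`
    (hP : P ∈ Matrix.rowStochastic ℝ (Fin (n + 1))) (hErg : P.IsPrimitive)
    -- `pi` is its stationary distribution, and the chain is time-reversible
    (hpi : pi ∈ stdSimplex ℝ (Fin (n + 1))) (hstat : Matrix.vecMul pi P = pi)
    (hrev : ∀ i j, pi i * P i j = pi j * P j i)
    -- the smallest reduced eigenvalue `λ_r` of `P` is nonnegative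
    (hlam : 0 ≤ StarLink.redLambda P (Fin.last (StarLink.numRed P))) :
    ∃ L : Matrix (Fin (StarLink.numRed P + 1)) (Fin (n + 1)) ℝ,
      StarLink.IsQuasiIntertwining pi (StarLink.absorb P)
        (StarLink.starPi (StarLink.redLambda P) (StarLink.redGamma P))
        (StarLink.absorb (StarLink.starP (StarLink.redLambda P) (StarLink.redGamma P))) L ∧
      Matrix.mulVec L (Pi.single 0 1) = Pi.single 0 1 ∧
      -- row `0` is `δ₀`, and row `i ≥ 1` is `δ₀ + (-v·1 | v)` with `v` a left eigenvector of `P₀`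
      -- for the eigenvalue `γ_i`
      L 0 = Pi.single 0 1 ∧
      ∀ i : Fin (StarLink.numRed P), ∃ v : Fin n → ℝ,
        v ≠ 0 ∧ Matrix.vecMul v (StarLink.delZero P) = StarLink.redGamma P i • v ∧
        L i.succ = Pi.single 0 1 + Fin.cons (-∑ j, v j) v :=
  theorem3p10_general n P pi hP hErg.isIrreducible hpi hrev
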